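/- Let $d\ge 1$, let $X\subseteq\mathbb{R}^d$ be a measurable set of positive Lebesgue measure, and write $\langle h\rangle=\int_X h(x)\,dx$. Let $\mathcal{F}$ be a set of nonnegative measurable functions on $X$, none of them almost everywhere zero, that contains every nonnegative measurable function with finitely many values and bounded support that is not almost everywhere zero. Let $\mathcal{P}=\{p\in\mathcal{F}:\langle p\rangle=1\}$. Let $U,V:[0,\infty)\to\mathbb{R}$ be continuous on $[0,\infty)$ and differentiable on $(0,\infty)$ with $V(0)=0$, such that $gU(f)$ and $V(f)$ are integrable for all $g,f\in\mathcal{F}$, and let $T:\mathbb{R}^2\to\mathbb{R}$ be differentiable at $(\langle gU(g)\rangle,\langle V(g)\rangle)$ for every $g\in\mathcal{F}$. Suppose that the composite scoring rule $$S(g,f)=T\bigl(\langle gU(f)\rangle,\langle V(f)\rangle\bigr),\qquad g,f\in\mathcal{F},$$ is strictly proper: $S(g,f)\ge S(g,g)$ for all $g,f\in\mathcal{F}$, and for $q,p\in\mathcal{P}$, $S(q,p)=S(q,q)$ if and only if $q=p$ almost everywhere. Let $\gamma>0$, let $\eta:[0,\infty)\to\mathbb{R}$ satisfy $\eta(1)=-1$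 and $\eta(z)\ge -z^{1+\gamma}$ for all $z\ge 0$, and let $u,v:\mathbb{R}\to\mathbb{R}$ be strictly increasing and continuous. Suppose that for all $g,f\in\mathcal{F}$ the quotient $u(\langle gU(f)\rangle)/v(\langle V(f)\rangle)$ is defined and nonnegative, $$S(g,f)=\eta\!\left(\frac{u(\langle gU(f)\rangle)}{v(\langle V(f)\rangle)}\right)v(\langle V(f)\rangle),$$ and $u(\langle gU(g)\rangle)=v(\langle V(g)\rangle)$. Then there are constants $a,c\in\mathbb{R}\setminus\{0\}$ such that for all $z\ge 0$ $$U(z)=c\,z^{\gamma},\qquad V(z)=\frac{c}{a}\,z^{1+\gamma},\qquad u(az)=v(z),$$ and for all $g,f\in\mathcal{F}$ the integrals $\langle gf^\gamma\rangle$ and $\langle f^{1+\gamma}\rangle$ are finite and $$S(g,f)=\eta\!\left(\frac{u(c\langle gf^{\gamma}\rangle)}{u(c\langle f^{1+\gamma}\rangle)}\right)u(c\langle f^{1+\gamma}\rangle).$$ -/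

import Mathlib

open MeasureTheory

/-- Lebesgue measure of `ℝ^d` on a measurable subset `X`. -/
noncomputable abbrev lebesgueOn {d : ℕ} (X : Set (EuclideanSpace ℝ (Fin d))) : Measure X :=
  Measure.comap Subtype.val volume

/-- The nonnegative measurable functions on `X ⊆ ℝ^d` that are not (almost everywhere) zero. -/
def nonnegFunctions {d : ℕ} (X : Set (EuclideanSpace ℝ (Fin d))) : Set (X → ℝ) :=
  {f | Measurable f ∧ (∀ x, 0 ≤ f x) ∧ ¬ (f =ᵐ[lebesgueOn X] 0)}

/-- A family of nonnegative functions that contains every nonnegative step function with bounded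
support (finitely many values) that is not almost everywhere zero. -/
structure IsRichFamily {d : ℕ} {X : Set (EuclideanSpace ℝ (Fin d))} (F : Set (X → ℝ)) : Prop where
  subset_nonneg : F ⊆ nonnegFunctions X
  step_mem : ∀ f ∈ nonnegFunctions X, (Set.range f).Finite →
    Bornology.IsBounded (Function.support f) → f ∈ F

/-- The composite scoring rule `S(g, f) = T(⟨g U(f)⟩, ⟨V(f)⟩)`.
`U` and `V` are only ever evaluated at nonnegative numbers. -/
noncomputable def compositeScore {d : ℕ} {X : Set (EuclideanSpace ℝ (Fin d))}
    (T : ℝ × ℝ → ℝ) (U V : ℝ → ℝ) (g f : X → ℝ) : ℝ :=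
  T (∫ x, g x * U (f x) ∂lebesgueOn X, ∫ x, V (f x) ∂lebesgueOn X)

/-- The integrals that enter the composite scoring rule are finite on the family `F`, so that the
rule is a well-defined real-valued function on `F × F`. -/
structure HasFiniteIntegrals {d : ℕ} {X : Set (EuclideanSpace ℝ (Fin d))}
    (F : Set (X → ℝ)) (U V : ℝ → ℝ) : Prop where
  integrable_mul : ∀ g ∈ F, ∀ f ∈ F, Integrable (fun x => g x * U (f x)) (lebesgueOn X)
  integrable_comp : ∀ f ∈ F, Integrable (fun x => V (f x)) (lebesgueOn X)

/-- The probability densities in `F`. -/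
def densities {d : ℕ} {X : Set (EuclideanSpace ℝ (Fin d))} (F : Set (X → ℝ)) : Set (X → ℝ) :=
  {p | p ∈ F ∧ ∫ x, p x ∂lebesgueOn X = 1}

/-- Strict properness of a scoring rule on `F`. -/
structure IsStrictlyProper {d : ℕ} {X : Set (EuclideanSpace ℝ (Fin d))} (F : Set (X → ℝ))
    (S : (X → ℝ) → (X → ℝ) → ℝ) : Prop where
  le : ∀ g ∈ F, ∀ f ∈ F, S g g ≤ S g f
  eq_iff : ∀ q ∈ densities F, ∀ p ∈ densities F, S q p = S q q ↔ q =ᵐ[lebesgueOn X] p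

/-- Regularity of the functions `T`, `U`, `V` that define a composite scoring rule on `F`.
`T` has to be differentiable only at the points that occur in `S(g, g)`. -/
structure IsRegularScore {d : ℕ} {X : Set (EuclideanSpace ℝ (Fin d))} (F : Set (X → ℝ))
    (T : ℝ × ℝ → ℝ) (U V : ℝ → ℝ) : Prop where
  differentiable_T : ∀ g ∈ F, DifferentiableAt ℝ T (∫ x, g x * U (g x) ∂lebesgueOn X, ∫ x, V (g x) ∂lebesgueOn X)
  continuous_U : ContinuousOn U (Set.Ici 0)
  continuous_V : ContinuousOn V (Set.Ici 0)
  differentiable_U : ∀ z, 0 < z → DifferentiableAt ℝ U z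
  differentiable_V : ∀ z, 0 < z → DifferentiableAt ℝ V z
  V_zero : V 0 = 0

/-- The scoring rule `S` on `F` has the generalized Hölder form
`S(g, f) = η(u(⟨g U(f)⟩) / v(⟨V(f)⟩)) v(⟨V(f)⟩)`. The function `η` lives on `[0, ∞)`: the fields
`denom_ne_zero` and `ratio_nonneg` say that its argument is defined and lies there. -/
structure HasHolderForm {d : ℕ} {X : Set (EuclideanSpace ℝ (Fin d))} (F : Set (X → ℝ))
    (γ : ℝ) (η u v U V : ℝ → ℝ) (S : (X → ℝ) → (X → ℝ) → ℝ) : Prop where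
  strictMono_u : StrictMono u
  strictMono_v : StrictMono v
  continuous_u : Continuous u
  continuous_v : Continuous v
  eta_one : η 1 = -1
  eta_ge : ∀ z, 0 ≤ z → -z ^ (1 + γ) ≤ η z
  denom_ne_zero : ∀ f ∈ F, v (∫ x, V (f x) ∂lebesgueOn X) ≠ 0
  ratio_nonneg : ∀ g ∈ F, ∀ f ∈ F, 0 ≤ u (∫ x, g x * U (f x) ∂lebesgueOn X) / v (∫ x, V (f x) ∂lebesgueOn X)
  score_eq : ∀ g ∈ F, ∀ f ∈ F,
    S g f = η (u (∫ x, g x * U (f x) ∂lebesgueOn X) / v (∫ x, V (f x) ∂lebesgueOn X)) * v (∫ x, V (f x) ∂lebesgueOn X)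
  diagonal : ∀ g ∈ F, Integrable (fun x => g x * U (g x)) (lebesgueOn X) → Integrable (fun x => V (g x)) (lebesgueOn X) →
    u (∫ x, g x * U (g x) ∂lebesgueOn X) = v (∫ x, V (g x) ∂lebesgueOn X)

/-! Testing with functions that take two values on disjoint bounded sets of measures m and n turns
the hypotheses into relations between real numbers (`TwoStepRelations`). Since m and n vary and u is
injective, the diagonal identity u(⟨gU(g)⟩) = v(⟨V(g)⟩) forces zU(z) = aV(z) with a > 0
(`exists_proportional`).

On the diagonal S(g,g) = -u(⟨gU(g)⟩), so properness makes f a minimizer of ⟨gU(g)⟩ among the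
two-step g with ⟨gU(f)⟩ = ⟨fU(f)⟩ (`le_of_cross_eq`). The first-order condition separates variables
(`deriv_symmetric`) and gives U(z) = c z^κ; strictness and continuity at 0 give κ > 0.

Finally, S(yf,f) as a function of y has a lower bound from properness, with exponent κ, and its
quotient by u(⟨fU(f)⟩) has one from the bound on η, with exponent γ. Both are attained at y = 1, and
comparing slopes there gives κ = γ (`exponent_eq`). -/

/-! ### Step functions on sets of prescribed measure -/

theorem exists_disjoint_bounded_sets {d : ℕ} (hd : 1 ≤ d) {X : Set (EuclideanSpace ℝ (Fin d))}
    (hX : MeasurableSet X) (hXpos : volume X ≠ 0) :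
    ∃ M : ℝ, 0 < M ∧ ∀ m n : ℝ, 0 < m → 0 < n → m + n ≤ M → ∃ A B : Set X,
      MeasurableSet A ∧ MeasurableSet B ∧ Disjoint A B ∧
      Bornology.IsBounded A ∧ Bornology.IsBounded B ∧
      lebesgueOn X A = ENNReal.ofReal m ∧ lebesgueOn X B = ENNReal.ofReal n := by
  have : Nonempty (Fin d) := ⟨⟨0, hd⟩⟩
  set ν := lebesgueOn X with hν
  have happ : ∀ t : Set X, ν t = volume (Subtype.val '' t) :=
    fun t => comap_subtype_coe_apply hX volume t
  have hnorm : Measurable (fun p : X => ‖(p : EuclideanSpace ℝ (Fin d))‖) := by fun_prop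
  let D : ℕ → Set X := fun k => {p | ‖(p : EuclideanSpace ℝ (Fin d))‖ ≤ k}
  have hDm : ∀ k, MeasurableSet (D k) := fun k => measurableSet_le hnorm measurable_const
  obtain ⟨k, hk⟩ : ∃ k, ν (D k) ≠ 0 := by
    by_contra! h
    apply hXpos
    have h1 : ν (⋃ k, D k) = 0 := measure_iUnion_null h
    have h2 : (⋃ k, D k) = Set.univ := by
      ext p
      simp only [Set.mem_iUnion, Set.mem_univ, iff_true]
      exact exists_nat_ge ‖(p : EuclideanSpace ℝ (Fin d))‖
    rw [h2, happ] at h1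
    simpa using h1
  have hfin : ν (D k) < ⊤ := by
    rw [happ]
    refine lt_of_le_of_lt (measure_mono ?_)
      (measure_closedBall_lt_top (x := (0 : EuclideanSpace ℝ (Fin d))) (r := (k : ℝ)))
    rintro _ ⟨p, hp, rfl⟩
    simpa [D] using hp
  have : IsFiniteMeasure (ν.restrict (D k)) := ⟨by simpa using hfin⟩
  -- The sets will be spherical shells in X: the distribution ρ of the norm has no atoms, so its
  -- distribution function attains every intermediate value.
  set ρ : Measure ℝ := (ν.restrict (D k)).map (fun p : X => ‖(p : EuclideanSpace ℝ (Fin d))‖) with hρ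
  have hρapp : ∀ s, MeasurableSet s →
      ρ s = ν ((fun p : X => ‖(p : EuclideanSpace ℝ (Fin d))‖) ⁻¹' s ∩ D k) := fun s hs => by
    rw [hρ, Measure.map_apply hnorm hs, Measure.restrict_apply (hnorm hs)]
  have : IsFiniteMeasure ρ := by rw [hρ]; infer_instance
  -- Spheres are null, even of radius 0, because d ≥ 1.
  have : NullSingletonClass ρ := ⟨fun r => by
    rw [hρapp _ (measurableSet_singleton r), happ]
    refine measure_mono_null ?_ (Measure.addHaar_sphere volume (0 : EuclideanSpace ℝ (Fin d)) r)
    rintro _ ⟨p, hp, rfl⟩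
    simpa using hp.1⟩
  -- This difference is the interval integral of 1 from -1 to b. The base point -1 lies below every
  -- norm, so norm 0 is included.
  have hcont : Continuous fun b => ρ.real (Set.Ioc (-1) b) - ρ.real (Set.Ioc b (-1)) := by
    have := intervalIntegral.continuous_primitive (μ := ρ) (f := fun _ => (1 : ℝ))
      (fun a b => by simp) (-1)
    refine this.congr fun b => ?_
    simp [intervalIntegral]
  have hval : ∀ b, -1 ≤ b → ρ.real (Set.Ioc (-1) b) - ρ.real (Set.Ioc b (-1)) =
      ρ.real (Set.Ioc (-1) b) := fun b hb => by simp [Set.Ioc_eq_empty (not_lt.2 hb)]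
  have htop : ρ (Set.Ioc (-1) (k : ℝ)) = ν (D k) := by
    rw [hρapp _ measurableSet_Ioc]
    congr 1
    ext p
    simp only [Set.mem_inter_iff, Set.mem_preimage, Set.mem_Ioc, D, Set.mem_ofPred_eq]
    refine ⟨fun h => h.2, fun h => ⟨⟨?_, h⟩, h⟩⟩
    linarith [norm_nonneg (p : EuclideanSpace ℝ (Fin d))]
  have hk0 : (-1 : ℝ) ≤ k := by linarith [(Nat.cast_nonneg k : (0 : ℝ) ≤ k)]
  have hivt : ∀ m, 0 ≤ m → m ≤ ν.real (D k) →
      ∃ b, -1 ≤ b ∧ ρ.real (Set.Ioc (-1) b) = m := fun m h0 h1 => by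
    have := intermediate_value_Icc hk0 hcont.continuousOn
    obtain ⟨b, hb, hb'⟩ := this (show m ∈ Set.Icc _ _ from by
      rw [hval _ hk0]
      refine ⟨by simpa using h0, ?_⟩
      simpa [Measure.real, htop] using h1)
    exact ⟨b, hb.1, by rw [← hval b hb.1]; exact hb'⟩
  refine ⟨ν.real (D k), ENNReal.toReal_pos hk hfin.ne, fun m n hm hn hmn => ?_⟩
  obtain ⟨b, hb, hbm⟩ := hivt m hm.le (by linarith)
  obtain ⟨b', hb', hbn⟩ := hivt (m + n) (by linarith) hmn
  have hbb : b ≤ b' := by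
    by_contra! h
    have : ρ.real (Set.Ioc (-1) b') ≤ ρ.real (Set.Ioc (-1) b) :=
      measureReal_mono (Set.Ioc_subset_Ioc_right h.le)
    linarith
  have hsplit : ρ.real (Set.Ioc b b') = n := by
    have := measureReal_union (μ := ρ) (Set.Ioc_disjoint_Ioc_of_le (le_refl b) (a := -1) (d := b'))
      measurableSet_Ioc
    rw [Set.Ioc_union_Ioc_eq_Ioc hb hbb] at this
    linarith
  have hbound : ∀ s : Set ℝ,
      Bornology.IsBounded ((fun p : X => ‖(p : EuclideanSpace ℝ (Fin d))‖) ⁻¹' s ∩ D k) := by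
    intro s
    rw [← Bornology.isBounded_image_subtype_val]
    refine (Metric.isBounded_closedBall (x := (0 : EuclideanSpace ℝ (Fin d))) (r := (k : ℝ))).subset ?_
    rintro _ ⟨p, hp, rfl⟩
    simpa [D] using hp.2
  refine ⟨_, _, (hnorm measurableSet_Ioc).inter (hDm k), (hnorm measurableSet_Ioc).inter (hDm k), ?_,
    hbound (Set.Ioc (-1) b), hbound (Set.Ioc b b'), ?_, ?_⟩
  · refine Disjoint.mono Set.inter_subset_left Set.inter_subset_left ?_
    exact (Set.Ioc_disjoint_Ioc_of_le le_rfl).preimage _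
  · rw [← hρapp _ measurableSet_Ioc, ← hbm, ofReal_measureReal]
  · rw [← hρapp _ measurableSet_Ioc, ← hsplit, ofReal_measureReal]

/-- The function with value `x` on `A`, value `y` on `B`, and `0` elsewhere. -/
noncomputable def twoStep {α : Type*} (A B : Set α) (x y : ℝ) : α → ℝ :=
  fun p => A.indicator (fun _ => x) p + B.indicator (fun _ => y) p

section twoStep

variable {α : Type*} {A B : Set α}

theorem twoStep_left (hAB : Disjoint A B) {p : α} (hp : p ∈ A) (x y : ℝ) :
    twoStep A B x y p = x := by
  simp [twoStep, hp, Set.disjoint_left.1 hAB hp]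

theorem twoStep_right (hAB : Disjoint A B) {p : α} (hp : p ∈ B) (x y : ℝ) :
    twoStep A B x y p = y := by
  simp [twoStep, hp, Set.disjoint_right.1 hAB hp]

theorem twoStep_outside {p : α} (hA : p ∉ A) (hB : p ∉ B) (x y : ℝ) :
    twoStep A B x y p = 0 := by
  simp [twoStep, hA, hB]

theorem twoStep_map₂ (hAB : Disjoint A B) {Φ : ℝ → ℝ → ℝ} (hΦ : Φ 0 0 = 0) (x' y' x y : ℝ) :
    (fun p => Φ (twoStep A B x' y' p) (twoStep A B x y p)) =
      twoStep A B (Φ x' x) (Φ y' y) := by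
  ext p
  by_cases hA : p ∈ A
  · simp [twoStep_left hAB hA]
  · by_cases hB : p ∈ B
    · simp [twoStep_right hAB hB]
    · simp [twoStep_outside hA hB, hΦ]

theorem integral_twoStep [MeasurableSpace α] {μ : Measure α} (hA : MeasurableSet A)
    (hB : MeasurableSet B) (hA' : μ A ≠ ⊤) (hB' : μ B ≠ ⊤) (x y : ℝ) :
    ∫ p, twoStep A B x y p ∂μ = μ.real A * x + μ.real B * y := by
  unfold twoStep
  rw [integral_add, integral_indicator_const _ hA, integral_indicator_const _ hB]
  · simp
  · exact (integrableOn_const hA').integrable_indicator hA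
  · exact (integrableOn_const hB').integrable_indicator hB

end twoStep

theorem exists_step_family {d : ℕ} (hd : 1 ≤ d) {X : Set (EuclideanSpace ℝ (Fin d))}
    (hX : MeasurableSet X) (hXpos : volume X ≠ 0) {F : Set (X → ℝ)} (hF : IsRichFamily F) :
    ∃ M : ℝ, 0 < M ∧ ∀ m n : ℝ, 0 < m → 0 < n → m + n ≤ M → ∃ s : ℝ → ℝ → X → ℝ,
      (∀ x y, 0 ≤ x → 0 ≤ y → 0 < x + y → s x y ∈ F) ∧
      (∀ Φ : ℝ → ℝ → ℝ, Φ 0 0 = 0 → ∀ x' y' x y,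
        ∫ p, Φ (s x' y' p) (s x y p) ∂lebesgueOn X = m * Φ x' x + n * Φ y' y) ∧
      (∀ x, s x 0 =ᵐ[lebesgueOn X] s 0 x → x = 0) := by
  obtain ⟨M, hM, h⟩ := exists_disjoint_bounded_sets hd hX hXpos
  refine ⟨M, hM, fun m n hm hn hmn => ?_⟩
  obtain ⟨A, B, hA, hB, hAB, hbA, hbB, hμA, hμB⟩ := h m n hm hn hmn
  have hA0 : lebesgueOn X A ≠ 0 := by simpa [hμA] using hm
  have hB0 : lebesgueOn X B ≠ 0 := by simpa [hμB] using hn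
  have key : ∀ (S : Set X) (f g : X → ℝ), lebesgueOn X S ≠ 0 → f =ᵐ[lebesgueOn X] g →
      ∃ p ∈ S, f p = g p := by
    intro S f g hS hfg
    by_contra! hne
    exact hS (measure_mono_null (fun p hp => hne p hp) (ae_iff.1 hfg))
  refine ⟨twoStep A B, fun x y hx hy hxy => ?_, fun Φ hΦ x' y' x y => ?_, fun x hx => ?_⟩
  · apply hF.step_mem
    · refine ⟨?_, fun p => add_nonneg (Set.indicator_nonneg (fun _ _ => hx) _)
        (Set.indicator_nonneg (fun _ _ => hy) _), fun h0 => ?_⟩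
      · exact (measurable_const.indicator hA).add (measurable_const.indicator hB)
      · obtain ⟨p, hp, hp'⟩ := key A _ _ hA0 h0
        obtain ⟨q, hq, hq'⟩ := key B _ _ hB0 h0
        rw [twoStep_left hAB hp] at hp'
        rw [twoStep_right hAB hq] at hq'
        simp only [Pi.zero_apply] at hp' hq'
        linarith
    · refine (Set.toFinite {x, y, 0}).subset ?_
      rintro _ ⟨p, rfl⟩
      by_cases hpA : p ∈ A
      · simp [twoStep_left hAB hpA]
      · by_cases hpB : p ∈ B
        · simp [twoStep_right hAB hpB]
        · simp [twoStep_outside hpA hpB]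
    · refine (hbA.union hbB).subset fun p hp => ?_
      by_contra hcon
      rw [Set.mem_union, not_or] at hcon
      exact hp (twoStep_outside hcon.1 hcon.2 x y)
  · rw [twoStep_map₂ hAB hΦ, integral_twoStep hA hB (by simp [hμA]) (by simp [hμB])]
    simp [Measure.real, hμA, hμB, hm.le, hn.le]
  · obtain ⟨p, hp, hp'⟩ := key A _ _ hA0 hx
    rwa [twoStep_left hAB hp, twoStep_left hAB hp] at hp'

/-! ### Reduction to relations between real numbers -/

/-- The relations between real numbers obtained by evaluating a score of generalized Hölder form
at functions with two nonzero values, taken on sets of measure `m` and `n`. -/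
structure TwoStepRelations (M γ : ℝ) (T : ℝ × ℝ → ℝ) (U V η u v : ℝ → ℝ) : Prop where
  pos : 0 < M
  diagonal : ∀ m n x y, 0 < m → 0 < n → m + n ≤ M → 0 ≤ x → 0 ≤ y → 0 < x + y →
    u (m * (x * U x) + n * (y * U y)) = v (m * V x + n * V y)
  denom_ne_zero : ∀ m n x y, 0 < m → 0 < n → m + n ≤ M → 0 ≤ x → 0 ≤ y → 0 < x + y →
    v (m * V x + n * V y) ≠ 0
  differentiable : ∀ m n x y, 0 < m → 0 < n → m + n ≤ M → 0 ≤ x → 0 ≤ y → 0 < x + y →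
    DifferentiableAt ℝ T (m * (x * U x) + n * (y * U y), m * V x + n * V y)
  proper : ∀ m n x' y' x y, 0 < m → 0 < n → m + n ≤ M → 0 ≤ x' → 0 ≤ y' → 0 < x' + y' →
    0 ≤ x → 0 ≤ y → 0 < x + y →
    T (m * (x' * U x') + n * (y' * U y'), m * V x' + n * V y') ≤
      T (m * (x' * U x) + n * (y' * U y), m * V x + n * V y)
  ratio_nonneg : ∀ m n x' y' x y, 0 < m → 0 < n → m + n ≤ M → 0 ≤ x' → 0 ≤ y' → 0 < x' + y' →
    0 ≤ x → 0 ≤ y → 0 < x + y →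
    0 ≤ u (m * (x' * U x) + n * (y' * U y)) / v (m * V x + n * V y)
  score_eq : ∀ m n x' y' x y, 0 < m → 0 < n → m + n ≤ M → 0 ≤ x' → 0 ≤ y' → 0 < x' + y' →
    0 ≤ x → 0 ≤ y → 0 < x + y →
    T (m * (x' * U x) + n * (y' * U y), m * V x + n * V y) =
      η (u (m * (x' * U x) + n * (y' * U y)) / v (m * V x + n * V y)) * v (m * V x + n * V y)
  nonconst : ∀ m, 0 < m → m + m ≤ M → U 0 ≠ U m⁻¹

theorem exists_twoStepRelations {d : ℕ} (hd : 1 ≤ d) {X : Set (EuclideanSpace ℝ (Fin d))}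
    (hX : MeasurableSet X) (hXpos : volume X ≠ 0) {F : Set (X → ℝ)} (hF : IsRichFamily F)
    {T : ℝ × ℝ → ℝ} {U V : ℝ → ℝ} (hfin : HasFiniteIntegrals F U V)
    (hreg : IsRegularScore F T U V) (hproper : IsStrictlyProper F (compositeScore T U V))
    {γ : ℝ} {η u v : ℝ → ℝ} (hform : HasHolderForm F γ η u v U V (compositeScore T U V)) :
    ∃ M, TwoStepRelations M γ T U V η u v := by
  obtain ⟨M, hM, h₀⟩ := exists_step_family hd hX hXpos hF
  have h : ∀ m n : ℝ, 0 < m → 0 < n → m + n ≤ M → ∃ s : ℝ → ℝ → X → ℝ,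
      (∀ x y, 0 ≤ x → 0 ≤ y → 0 < x + y → s x y ∈ F) ∧
      (∀ x' y' x y, ∫ p, s x' y' p * U (s x y p) ∂lebesgueOn X =
        m * (x' * U x) + n * (y' * U y)) ∧
      (∀ x y, ∫ p, V (s x y p) ∂lebesgueOn X = m * V x + n * V y) ∧
      (∀ x y, ∫ p, s x y p ∂lebesgueOn X = m * x + n * y) ∧
      (∀ x, s x 0 =ᵐ[lebesgueOn X] s 0 x → x = 0) := by
    intro m n hm hn hmn
    obtain ⟨s, hs, hint, hne⟩ := h₀ m n hm hn hmn
    exact ⟨s, hs, hint (fun a b => a * U b) (by simp),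
      fun x y => hint (fun _ b => V b) hreg.V_zero 0 0 x y,
      fun x y => hint (fun _ b => b) rfl 0 0 x y, hne⟩
  refine ⟨M, hM, ?_, ?_, ?_, ?_, ?_, ?_, ?_⟩
  · intro m n x y hm hn hmn hx hy hxy
    obtain ⟨s, hs, hintU, hintV, -, -⟩ := h m n hm hn hmn
    have hf := hs x y hx hy hxy
    have := hform.diagonal _ hf (hfin.integrable_mul _ hf _ hf) (hfin.integrable_comp _ hf)
    rwa [hintU, hintV] at this
  · intro m n x y hm hn hmn hx hy hxy
    obtain ⟨s, hs, hintU, hintV, -, -⟩ := h m n hm hn hmn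
    have := hform.denom_ne_zero _ (hs x y hx hy hxy)
    rwa [hintV] at this
  · intro m n x y hm hn hmn hx hy hxy
    obtain ⟨s, hs, hintU, hintV, -, -⟩ := h m n hm hn hmn
    have := hreg.differentiable_T _ (hs x y hx hy hxy)
    rwa [hintU, hintV] at this
  · intro m n x' y' x y hm hn hmn hx' hy' hxy' hx hy hxy
    obtain ⟨s, hs, hintU, hintV, -, -⟩ := h m n hm hn hmn
    have := hproper.le _ (hs x' y' hx' hy' hxy') _ (hs x y hx hy hxy)
    unfold compositeScore at this
    rwa [hintU, hintV, hintU, hintV] at this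
  · intro m n x' y' x y hm hn hmn hx' hy' hxy' hx hy hxy
    obtain ⟨s, hs, hintU, hintV, -, -⟩ := h m n hm hn hmn
    have := hform.ratio_nonneg _ (hs x' y' hx' hy' hxy') _ (hs x y hx hy hxy)
    rwa [hintU, hintV] at this
  · intro m n x' y' x y hm hn hmn hx' hy' hxy' hx hy hxy
    obtain ⟨s, hs, hintU, hintV, -, -⟩ := h m n hm hn hmn
    have := hform.score_eq _ (hs x' y' hx' hy' hxy') _ (hs x y hx hy hxy)
    unfold compositeScore at this
    rwa [hintU, hintV] at this
  -- If U(0) = U(1/m), the normalized indicators of the two sets of measure m have equal scores,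
  -- against strictness.
  · intro m hm hmn heq
    obtain ⟨s, hs, hintU, hintV, hint, hne⟩ := h m m hm hm hmn
    have hi := inv_pos.2 hm
    have hq := hs m⁻¹ 0 hi.le le_rfl (by simpa using hm)
    have hp := hs 0 m⁻¹ le_rfl hi.le (by simpa using hm)
    have hq1 : s m⁻¹ 0 ∈ densities F := ⟨hq, by
      rw [hint]; simp [hm.ne']⟩
    have hp1 : s 0 m⁻¹ ∈ densities F := ⟨hp, by
      rw [hint]; simp [hm.ne']⟩
    refine hi.ne' (hne _ ((hproper.eq_iff _ hq1 _ hp1).1 ?_))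
    unfold compositeScore
    rw [hintU, hintV, hintU, hintV]
    simp [heq, hreg.V_zero]

/-! ### Power laws -/

open Filter Topology in
theorem eq_mul_rpow_of_hasDerivAt {U : ℝ → ℝ} {κ : ℝ}
    (hU : ∀ z, 0 < z → DifferentiableAt ℝ U z) (hode : ∀ z, 0 < z → z * deriv U z = κ * U z) :
    ∀ z, 0 < z → U z = U 1 * z ^ κ := by
  have hd : ∀ z ∈ Set.Ioi (0 : ℝ), HasDerivAt (fun z => U z * z ^ (-κ)) 0 z := by
    intro z hz
    have hz : 0 < z := hz
    have h := (hU z hz).hasDerivAt.mul (Real.hasDerivAt_rpow_const (p := -κ) (Or.inl hz.ne'))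
    have hzκ : z ^ (-κ) = z ^ (-κ - 1) * z := by
      rw [← Real.rpow_add_one hz.ne']; congr 1; ring
    refine h.congr_deriv ?_
    rw [hzκ]
    linear_combination z ^ (-κ - 1) * hode z hz
  intro z hz
  have h := isOpen_Ioi.is_const_of_deriv_eq_zero (convex_Ioi (0 : ℝ)).isPreconnected
    (fun z hz => (hd z hz).differentiableAt.differentiableWithinAt)
    (fun z hz => (hd z hz).deriv) (Set.mem_Ioi.2 hz) (Set.mem_Ioi.2 one_pos)
  simp only [Real.one_rpow, mul_one] at h
  rw [← h, mul_assoc, ← Real.rpow_add hz]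
  simp

/-- Freezing y separates the variables, with κ = yU'(y)/U(y). -/
theorem eq_mul_rpow_of_symmetric {U : ℝ → ℝ}
    (hU : ∀ z, 0 < z → DifferentiableAt ℝ U z)
    (hsymm : ∀ x y, 0 < x → 0 < y → x * deriv U x * U y = y * deriv U y * U x)
    {y : ℝ} (hy : 0 < y) (hUy : U y ≠ 0) :
    ∃ κ c : ℝ, c ≠ 0 ∧ ∀ z, 0 < z → U z = c * z ^ κ := by
  have h := eq_mul_rpow_of_hasDerivAt (κ := y * deriv U y / U y) hU fun z hz => by
    field_simp
    linear_combination hsymm z y hz hy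
  refine ⟨_, U 1, fun h1 => hUy ?_, h⟩
  rw [h y hy, h1, zero_mul]

open Filter Topology in
-- For κ < 0 the power blows up at 0; for κ = 0 continuity would give U(0) = c = U(z).
theorem pos_exponent_of_continuousWithinAt {U : ℝ → ℝ} {κ c : ℝ} (hc : c ≠ 0)
    (hU0 : ContinuousWithinAt U (Set.Ici 0) 0) (hU : ∀ z, 0 < z → U z = c * z ^ κ)
    {z : ℝ} (hz : 0 < z) (hne : U 0 ≠ U z) : 0 < κ := by
  have ht : Tendsto (fun z : ℝ => c * z ^ κ) (𝓝[>] 0) (𝓝 (U 0)) := by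
    refine (hU0.mono_left (nhdsWithin_mono _ Set.Ioi_subset_Ici_self)).congr' ?_
    filter_upwards [self_mem_nhdsWithin] with z hz using hU z hz
  rcases lt_trichotomy κ 0 with h | h | h
  · have h1 := tendsto_rpow_neg_nhdsGT_zero h
    have h2 : Tendsto (fun z : ℝ => z ^ κ) (𝓝[>] 0) (𝓝 (c⁻¹ * U 0)) := by
      refine (ht.const_mul c⁻¹).congr fun z => ?_
      field_simp
    exact absurd h1 (not_tendsto_atTop_of_tendsto_nhds h2)
  · subst h
    refine absurd ?_ hne
    rw [hU z hz]
    refine tendsto_nhds_unique ht ?_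
    simp
  · exact h

/-! ### Proportionality of zU(z) and V(z) -/

namespace TwoStepRelations

variable {M γ : ℝ} {T : ℝ × ℝ → ℝ} {U V η u v : ℝ → ℝ}

theorem diagonal_single (R : TwoStepRelations M γ T U V η u v) (hV0 : V 0 = 0) {m x : ℝ}
    (hm : 0 < m) (hmM : m < M) (hx : 0 < x) : u (m * (x * U x)) = v (m * V x) := by
  have := R.diagonal m (M - m) x 0 hm (by linarith) (by linarith) hx.le le_rfl (by linarith)
  simpa [hV0] using this

open Filter Topology in
-- The measure of the support tends to 0 in the diagonal identity.
theorem zero_eq_zero (R : TwoStepRelations M γ T U V η u v) (hV0 : V 0 = 0)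
    (hu : Continuous u) (hv : Continuous v) : u 0 = v 0 := by
  have h1 : Tendsto (fun m : ℝ => u (m * (1 * U 1))) (𝓝[>] 0) (𝓝 (u 0)) := by
    have : Continuous fun m : ℝ => u (m * (1 * U 1)) := by fun_prop
    have h := this.tendsto 0
    simp only [zero_mul] at h
    exact h.mono_left nhdsWithin_le_nhds
  have h2 : Tendsto (fun m : ℝ => v (m * V 1)) (𝓝[>] 0) (𝓝 (v 0)) := by
    have : Continuous fun m : ℝ => v (m * V 1) := by fun_prop
    have h := this.tendsto 0
    simp only [zero_mul] at h
    exact h.mono_left nhdsWithin_le_nhds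
  refine tendsto_nhds_unique (h1.congr' ?_) h2
  filter_upwards [Ioo_mem_nhdsGT R.pos] with m hm
  exact R.diagonal_single hV0 hm.1 hm.2 one_pos

theorem mul_eq_zero_of_eq_zero (R : TwoStepRelations M γ T U V η u v) (hV0 : V 0 = 0)
    (hu : Continuous u) (hv : Continuous v) (hmu : StrictMono u) {x : ℝ} (hx : 0 < x)
    (h : V x = 0) : x * U x = 0 := by
  have h1 := R.diagonal_single hV0 (half_pos R.pos) (half_lt_self R.pos) hx
  rw [h, mul_zero, ← R.zero_eq_zero hV0 hu hv] at h1
  exact (mul_eq_zero.1 (hmu.injective h1)).resolve_left (half_pos R.pos).ne'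

theorem proportional (R : TwoStepRelations M γ T U V η u v) (hV0 : V 0 = 0)
    (hu : Continuous u) (hv : Continuous v) (hmu : StrictMono u) {x y : ℝ} (hx : 0 < x)
    (hy : 0 < y) : V y * (x * U x) = V x * (y * U y) := by
  by_cases hVx : V x = 0
  · rw [R.mul_eq_zero_of_eq_zero hV0 hu hv hmu hx hVx, hVx]; ring
  by_cases hVy : V y = 0
  · rw [R.mul_eq_zero_of_eq_zero hV0 hu hv hmu hy hVy, hVy]; ring
  have hax := abs_pos.2 hVx
  have hay := abs_pos.2 hVy
  have hsum : 0 < |V x| + |V y| := by positivity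
  -- The measures ε|V(y)| and ε|V(x)| have sum M/2. They make the two contributions to ⟨V⟩ cancel
  -- when the signs differ, and coincide when they agree.
  set ε := M / (2 * (|V x| + |V y|)) with hε
  have hε0 : 0 < ε := div_pos R.pos (by linarith)
  have hεM : ε * (|V x| + |V y|) = M / 2 := by rw [hε]; field_simp
  have hm : 0 < ε * |V y| := by positivity
  have hn : 0 < ε * |V x| := by positivity
  have hmn : ε * |V y| + ε * |V x| < M := by linarith [R.pos]
  rcases lt_or_gt_of_ne (mul_ne_zero hVx hVy) with hneg | hpos
  · have habs : |V y| * V x = -(|V x| * V y) := by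
      rcases abs_cases (V x) with ⟨h1, h1'⟩ | ⟨h1, h1'⟩ <;>
      rcases abs_cases (V y) with ⟨h2, h2'⟩ | ⟨h2, h2'⟩ <;> rw [h1, h2] <;> nlinarith
    have h := R.diagonal _ _ x y hm hn hmn.le hx.le hy.le (by linarith)
    have h0 : ε * |V y| * V x + ε * |V x| * V y = 0 := by linear_combination ε * habs
    rw [h0, ← R.zero_eq_zero hV0 hu hv] at h
    have h := hmu.injective h
    have h3 : |V y| * (x * U x) + |V x| * (y * U y) = 0 := by
      refine (mul_eq_zero.1 (?_ : ε * _ = 0)).resolve_left hε0.ne'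
      linear_combination h
    refine mul_left_cancel₀ hay.ne' ?_
    linear_combination V y * h3 - (y * U y) * habs
  · have habs : |V y| * V x = |V x| * V y := by
      rcases abs_cases (V x) with ⟨h1, h1'⟩ | ⟨h1, h1'⟩ <;>
      rcases abs_cases (V y) with ⟨h2, h2'⟩ | ⟨h2, h2'⟩ <;> rw [h1, h2] <;> nlinarith
    have h1 := R.diagonal_single hV0 hm (by linarith) hx
    have h2 := R.diagonal_single hV0 hn (by linarith) hy
    have h0 : ε * |V y| * V x = ε * |V x| * V y := by linear_combination ε * habs
    rw [h0, ← h2] at h1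
    have h := hmu.injective h1
    have h3 : |V y| * (x * U x) = |V x| * (y * U y) := by
      refine mul_left_cancel₀ hε0.ne' ?_
      linear_combination h
    refine mul_left_cancel₀ hay.ne' ?_
    linear_combination V y * h3 - (y * U y) * habs

open Filter Topology in
theorem exists_proportional (R : TwoStepRelations M γ T U V η u v) (hV0 : V 0 = 0)
    (hU0 : ContinuousWithinAt U (Set.Ici 0) 0)
    (hu : Continuous u) (hv : Continuous v) (hmu : StrictMono u) (hmv : StrictMono v) :
    ∃ a : ℝ, 0 < a ∧ (∀ z, 0 ≤ z → z * U z = a * V z) ∧ ∃ y, 0 < y ∧ U y ≠ 0 := by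
  -- If V vanished on (0,∞), so would U, and by continuity U(0) = 0, against `nonconst`.
  obtain ⟨y, hy, hVy⟩ : ∃ y, 0 < y ∧ V y ≠ 0 := by
    by_contra! h
    have hU : ∀ z, 0 < z → U z = 0 := fun z hz =>
      (mul_eq_zero.1 (R.mul_eq_zero_of_eq_zero hV0 hu hv hmu hz (h z hz))).resolve_left hz.ne'
    refine R.nonconst (M / 2) (half_pos R.pos) (by linarith) ?_
    rw [hU _ (inv_pos.2 (half_pos R.pos))]
    refine tendsto_nhds_unique (hU0.mono_left (nhdsWithin_mono _ Set.Ioi_subset_Ici_self)) ?_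
    refine tendsto_const_nhds.congr' ?_
    filter_upwards [self_mem_nhdsWithin] with z hz using (hU z hz).symm
  have hd := R.diagonal_single hV0 (half_pos R.pos) (half_lt_self R.pos) hy
  have h0 := R.zero_eq_zero hV0 hu hv
  have hM := half_pos R.pos
  -- As u and v increase from the same value at 0, yU(y) and V(y) have the same sign.
  have ha : 0 < y * U y / V y := by
    rcases lt_or_gt_of_ne hVy with h | h
    · refine div_pos_of_neg_of_neg ?_ h
      have : u (M / 2 * (y * U y)) < u 0 := by
        rw [hd, h0]; exact hmv (mul_neg_of_pos_of_neg hM h)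
      exact (pos_iff_neg_of_mul_neg (hmu.lt_iff_lt.1 this)).1 hM
    · refine div_pos ?_ h
      have : u 0 < u (M / 2 * (y * U y)) := by
        rw [hd, h0]; exact hmv (mul_pos hM h)
      exact (pos_iff_pos_of_mul_pos (hmu.lt_iff_lt.1 this)).1 hM
  refine ⟨_, ha, fun z hz => ?_, y, hy, ?_⟩
  · rcases hz.eq_or_lt with rfl | hz
    · simp [hV0]
    · have := R.proportional hV0 hu hv hmu hz hy
      field_simp
      linear_combination this
  · rintro h
    simp [h] at ha

/-! ### First-order conditions and the exponent -/

theorem apply_diagonal (R : TwoStepRelations M γ T U V η u v) (hη : η 1 = -1)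
    {m n x y : ℝ} (hm : 0 < m) (hn : 0 < n) (hmn : m + n ≤ M) (hx : 0 ≤ x) (hy : 0 ≤ y)
    (hxy : 0 < x + y) :
    T (m * (x * U x) + n * (y * U y), m * V x + n * V y) =
      -u (m * (x * U x) + n * (y * U y)) := by
  rw [R.score_eq m n x y x y hm hn hmn hx hy hxy hx hy hxy, R.diagonal m n x y hm hn hmn hx hy hxy,
    div_self (R.denom_ne_zero m n x y hm hn hmn hx hy hxy), hη, neg_one_mul]

/-- With equal cross terms, S(g,f) = S(f,f), so properness compares -u at the two diagonal terms. -/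
theorem le_of_cross_eq (R : TwoStepRelations M γ T U V η u v) (hη : η 1 = -1)
    (hmu : StrictMono u) {x' y' x y : ℝ} (hx' : 0 ≤ x') (hy' : 0 ≤ y') (hxy' : 0 < x' + y')
    (hx : 0 ≤ x) (hy : 0 ≤ y) (hxy : 0 < x + y)
    (h : x' * U x + y' * U y = x * U x + y * U y) :
    x * U x + y * U y ≤ x' * U x' + y' * U y' := by
  have hM := half_pos R.pos
  have hp := R.proper (M / 2) (M / 2) x' y' x y hM hM (by linarith) hx' hy' hxy' hx hy hxy
  have h' : M / 2 * (x' * U x) + M / 2 * (y' * U y) = M / 2 * (x * U x) + M / 2 * (y * U y) := by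
    linear_combination M / 2 * h
  rw [h', R.apply_diagonal hη hM hM (by linarith) hx hy hxy,
    R.apply_diagonal hη hM hM (by linarith) hx' hy' hxy', neg_le_neg_iff, hmu.le_iff_le,
    ← mul_add, ← mul_add] at hp
  exact le_of_mul_le_mul_left hp hM

open Filter Topology in
-- The perturbation (x + tU(y), y - tU(x)) keeps the cross term fixed, so the diagonal term has a
-- local minimum at t = 0.
theorem deriv_symmetric (R : TwoStepRelations M γ T U V η u v) (hη : η 1 = -1)
    (hmu : StrictMono u) (hU : ∀ z, 0 < z → DifferentiableAt ℝ U z) {x y : ℝ} (hx : 0 < x)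
    (hy : 0 < y) : x * deriv U x * U y = y * deriv U y * U x := by
  have hP : ∀ z, 0 < z → HasDerivAt (fun z => z * U z) (U z + z * deriv U z) z := fun z hz =>
    ((hasDerivAt_id z).mul (hU z hz).hasDerivAt).congr_deriv (by simp)
  have hl : HasDerivAt (fun t : ℝ => x + t * U y) (U y) 0 := by
    simpa using ((hasDerivAt_id (0 : ℝ)).mul_const (U y)).const_add x
  have hr : HasDerivAt (fun t : ℝ => y - t * U x) (-U x) 0 := by
    simpa using ((hasDerivAt_id (0 : ℝ)).mul_const (U x)).const_sub y
  have hl' : HasDerivAt (fun t : ℝ => (x + t * U y) * U (x + t * U y))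
      ((U x + x * deriv U x) * U y) 0 :=
    HasDerivAt.comp (h₂ := fun z => z * U z) 0 (by simpa using hP x hx) hl
  have hr' : HasDerivAt (fun t : ℝ => (y - t * U x) * U (y - t * U x))
      ((U y + y * deriv U y) * (-U x)) 0 :=
    HasDerivAt.comp (h₂ := fun z => z * U z) 0 (by simpa using hP y hy) hr
  have hmin : IsLocalMin (fun t : ℝ => (x + t * U y) * U (x + t * U y) +
      (y - t * U x) * U (y - t * U x)) 0 := by
    have h1 : ∀ᶠ t in 𝓝 (0 : ℝ), 0 < x + t * U y :=
      hl.continuousAt.eventually (lt_mem_nhds (by simpa using hx))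
    have h2 : ∀ᶠ t in 𝓝 (0 : ℝ), 0 < y - t * U x :=
      hr.continuousAt.eventually (lt_mem_nhds (by simpa using hy))
    filter_upwards [h1, h2] with t ht1 ht2
    have := R.le_of_cross_eq hη hmu ht1.le ht2.le (by linarith) hx.le hy.le (by linarith)
      (by ring)
    simpa using this
  have := hmin.hasDerivAt_eq_zero (hl'.add hr')
  linarith

/-- The exponent is determined by comparing two lower bounds for the score of a multiple of a
function, which both touch the score on the diagonal. -/
theorem exponent_eq (R : TwoStepRelations M γ T U V η u v) (hV0 : V 0 = 0) (hη : η 1 = -1)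
    (hηge : ∀ z, 0 ≤ z → -z ^ (1 + γ) ≤ η z) (hmu : StrictMono u) {a c κ : ℝ} (ha : 0 < a)
    (hc : 0 < c) (hκ : 0 < κ) (hU : ∀ z, 0 < z → U z = c * z ^ κ)
    (hV : ∀ z, 0 < z → V z = c / a * z ^ (1 + κ)) : κ = γ := by
  have hM := half_pos R.pos
  have hmn : M / 2 + M / 2 ≤ M := by linarith
  have hP : ∀ z, 0 < z → z * U z = c * z ^ (1 + κ) := fun z hz => by
    rw [hU z hz, Real.rpow_add hz, Real.rpow_one]; ring
  -- every positive `s` is of the form `⟨f U(f)⟩`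
  have hs : ∀ s, 0 < s → ∃ x, 0 < x ∧ M / 2 * (x * U x) = s ∧ M / 2 * V x = s / a := by
    intro s hs
    have hq : 0 < s / (M / 2 * c) := div_pos hs (by positivity)
    have hx := Real.rpow_pos_of_pos hq (1 + κ)⁻¹
    have hxp : ((s / (M / 2 * c)) ^ (1 + κ)⁻¹) ^ (1 + κ) = s / (M / 2 * c) :=
      Real.rpow_inv_rpow hq.le (by linarith)
    have hM' := R.pos.ne'
    refine ⟨_, hx, ?_, ?_⟩
    · rw [hP _ hx, hxp]; field_simp
    · rw [hV _ hx, hxp]; field_simp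
  have hdiff : ∀ s, 0 < s → DifferentiableAt ℝ T (s, s / a) := fun s h => by
    obtain ⟨x, hx, h1, h2⟩ := hs s h
    have := R.differentiable (M / 2) (M / 2) x 0 hM hM hmn hx.le le_rfl (by linarith)
    simpa [hV0, h1, h2] using this
  have hTu : ∀ s, 0 < s → T (s, s / a) = -u s := fun s h => by
    obtain ⟨x, hx, h1, h2⟩ := hs s h
    have := R.apply_diagonal hη hM hM hmn hx.le le_rfl (by linarith)
    simpa [hV0, h1, h2] using this
  -- u inherits differentiability from T along the ray (s, s/a).
  have hdu : ∀ s, 0 < s → DifferentiableAt ℝ u s := fun s h => by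
    have h1 : DifferentiableAt ℝ (fun s => T (s, s / a)) s :=
      DifferentiableAt.comp (g := T) (f := fun s : ℝ => (s, s / a)) s (hdiff s h) (by fun_prop)
    refine h1.neg.congr_of_eventuallyEq ?_
    filter_upwards [lt_mem_nhds h] with t ht
    simp [hTu t ht]
  obtain ⟨s, hs0, hsd⟩ : ∃ s, 0 < s ∧ deriv u s ≠ 0 := by
    by_contra! h
    have h12 := isOpen_Ioi.is_const_of_deriv_eq_zero (convex_Ioi (0 : ℝ)).isPreconnected
      (fun z hz => (hdu z hz).differentiableWithinAt) (fun z hz => h z hz)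
      (Set.mem_Ioi.2 one_pos) (Set.mem_Ioi.2 two_pos)
    linarith [hmu (one_lt_two : (1 : ℝ) < 2)]
  obtain ⟨x, hx, h1, h2⟩ := hs s hs0
  have hcross : ∀ y, M / 2 * (x * y * U x) + M / 2 * (0 * U 0) = s * y := fun y => by
    linear_combination y * h1
  have hpt : M / 2 * V x + M / 2 * V 0 = s / a := by rw [hV0]; linear_combination h2
  have hproper : ∀ y, 0 < y → -u (s * y ^ (1 + κ)) ≤ T (s * y, s / a) := fun y hy => by
    have hxy : 0 < x * y := mul_pos hx hy
    have hp := R.proper (M / 2) (M / 2) (x * y) 0 x 0 hM hM hmn hxy.le le_rfl (by linarith)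
      hx.le le_rfl (by linarith)
    rw [R.apply_diagonal hη hM hM hmn hxy.le le_rfl (by linarith), hcross, hpt] at hp
    convert hp using 3
    rw [hP _ hxy, Real.mul_rpow hx.le hy.le, ← h1, hP _ hx]; ring
  have hne : u s ≠ 0 := by
    have h3 := R.denom_ne_zero (M / 2) (M / 2) x 0 hM hM hmn hx.le le_rfl (by linarith)
    rw [← R.diagonal (M / 2) (M / 2) x 0 hM hM hmn hx.le le_rfl (by linarith)] at h3
    simpa [h1] using h3
  have hvs : v (s / a) = u s := by
    have h3 := R.diagonal (M / 2) (M / 2) x 0 hM hM hmn hx.le le_rfl (by linarith)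
    rw [hpt] at h3
    simpa [h1] using h3.symm
  -- Dividing by u(s) leaves η of the ratio, so the sign of u(s) is irrelevant.
  have hholder : ∀ y, 0 < y → 0 ≤ T (s * y, s / a) / u s + (u (s * y) / u s) ^ (1 + γ) :=
    fun y hy => by
    have hxy : 0 < x * y := mul_pos hx hy
    have hs1 := R.score_eq (M / 2) (M / 2) (x * y) 0 x 0 hM hM hmn hxy.le le_rfl (by linarith)
      hx.le le_rfl (by linarith)
    have hr := R.ratio_nonneg (M / 2) (M / 2) (x * y) 0 x 0 hM hM hmn hxy.le le_rfl (by linarith)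
      hx.le le_rfl (by linarith)
    rw [hcross, hpt, hvs] at hs1 hr
    rw [hs1, mul_div_assoc, div_self hne, mul_one]
    linarith [hηge _ hr]
  have hdT : DifferentiableAt ℝ (fun y => T (s * y, s / a)) 1 :=
    DifferentiableAt.comp (g := T) (f := fun y : ℝ => (s * y, s / a)) 1
      (by simpa using hdiff s hs0) (by fun_prop)
  have hTd := hdT.hasDerivAt
  set τ := deriv (fun y => T (s * y, s / a)) 1
  have hud := (hdu s hs0).hasDerivAt
  have hpow : HasDerivAt (fun y : ℝ => s * y ^ (1 + κ)) (s * (1 + κ)) 1 := by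
    have := (Real.hasDerivAt_rpow_const (x := 1) (p := 1 + κ) (Or.inl one_ne_zero)).const_mul s
    simpa using this
  have hA : HasDerivAt (fun y : ℝ => u (s * y ^ (1 + κ))) (deriv u s * (s * (1 + κ))) 1 :=
    HasDerivAt.comp (h₂ := u) 1 (by simpa using hud) hpow
  have hlin : HasDerivAt (fun y : ℝ => s * y) s 1 := by
    simpa using (hasDerivAt_id (1 : ℝ)).const_mul s
  have hB : HasDerivAt (fun y : ℝ => u (s * y) / u s) (deriv u s * s / u s) 1 :=
    (HasDerivAt.comp (h₂ := u) 1 (by simpa using hud) hlin).div_const _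
  have hB' : HasDerivAt (fun y : ℝ => (u (s * y) / u s) ^ (1 + γ))
      (deriv u s * s / u s * (1 + γ)) 1 := by
    have := hB.rpow_const (p := 1 + γ) (Or.inl (by simp [hne]))
    simpa [hne] using this
  have hmin1 : IsLocalMin (fun y : ℝ => T (s * y, s / a) + u (s * y ^ (1 + κ))) 1 := by
    filter_upwards [lt_mem_nhds (one_pos : (0 : ℝ) < 1)] with y hy
    simp only [mul_one, Real.one_rpow, hTu s hs0]
    linarith [hproper y hy]
  have hmin2 : IsLocalMin
      (fun y : ℝ => T (s * y, s / a) / u s + (u (s * y) / u s) ^ (1 + γ)) 1 := by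
    filter_upwards [lt_mem_nhds (one_pos : (0 : ℝ) < 1)] with y hy
    simp only [mul_one, hTu s hs0, neg_div, div_self hne, Real.one_rpow]
    linarith [hholder y hy]
  have e1 := hmin1.hasDerivAt_eq_zero (hTd.add hA)
  have e2 := hmin2.hasDerivAt_eq_zero ((hTd.div_const _).add hB')
  have e2' : τ + deriv u s * s * (1 + γ) = 0 := by
    field_simp at e2
    linear_combination e2
  have : deriv u s * s * (κ - γ) = 0 := by linear_combination e1 - e2'
  have := (mul_eq_zero.1 this).resolve_left (mul_ne_zero hsd hs0.ne')
  linarith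

theorem power_form (R : TwoStepRelations M γ T U V η u v) (hV0 : V 0 = 0) (hη : η 1 = -1)
    (hηge : ∀ z, 0 ≤ z → -z ^ (1 + γ) ≤ η z) (hu : Continuous u) (hv : Continuous v)
    (hmu : StrictMono u) (hmv : StrictMono v) (hU0 : ContinuousWithinAt U (Set.Ici 0) 0)
    (hU : ∀ z, 0 < z → DifferentiableAt ℝ U z) :
    ∃ a c : ℝ, 0 < a ∧ 0 < c ∧ (∀ z, 0 ≤ z → U z = c * z ^ γ) ∧
      (∀ z, 0 ≤ z → V z = c / a * z ^ (1 + γ)) ∧ ∀ z, 0 ≤ z → u (a * z) = v z := by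
  obtain ⟨a, ha, haV, y, hy, hUy⟩ := R.exists_proportional hV0 hU0 hu hv hmu hmv
  obtain ⟨κ, c, hc, hUc⟩ := eq_mul_rpow_of_symmetric hU
    (fun x y hx hy => R.deriv_symmetric hη hmu hU hx hy) hy hUy
  have hM := half_pos R.pos
  have hκ := pos_exponent_of_continuousWithinAt hc hU0 hUc (inv_pos.2 hM)
    (R.nonconst _ hM (by linarith))
  have hU00 : U 0 = 0 := by
    have h1 := hU0.mono_left (nhdsWithin_mono _ Set.Ioi_subset_Ici_self)
    refine tendsto_nhds_unique h1 (Filter.Tendsto.congr' (f₁ := fun z => c * z ^ κ) ?_ ?_)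
    · filter_upwards [self_mem_nhdsWithin] with z hz using (hUc z hz).symm
    · have := ((Real.continuousAt_rpow_const 0 κ (Or.inr hκ.le)).const_mul c).tendsto
      simp only [Real.zero_rpow hκ.ne', mul_zero] at this
      exact this.mono_left nhdsWithin_le_nhds
  have hUc' : ∀ z, 0 ≤ z → U z = c * z ^ κ := fun z hz => by
    rcases hz.eq_or_lt with rfl | hz
    · rw [hU00, Real.zero_rpow hκ.ne', mul_zero]
    · exact hUc z hz
  have hVc : ∀ z, 0 ≤ z → V z = c / a * z ^ (1 + κ) := fun z hz => by
    have h1 := haV z hz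
    rw [hUc' z hz] at h1
    rw [Real.rpow_add' hz (by linarith), Real.rpow_one]
    field_simp
    linear_combination -h1
  -- Comparing the value pairs (2,0) and (1,1) gives c ≤ c 2^κ, which rules out c < 0.
  have hc0 : 0 < c := by
    have h1 := R.le_of_cross_eq hη hmu (x' := 2) (y' := 0) (x := 1) (y := 1) (by norm_num) le_rfl
      (by norm_num) one_pos.le one_pos.le (by norm_num) (by ring)
    rw [hUc 1 one_pos, hUc 2 two_pos, Real.one_rpow] at h1
    have h2 : (1 : ℝ) < 2 ^ κ := Real.one_lt_rpow one_lt_two hκ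
    by_contra! hc'
    nlinarith [lt_of_le_of_ne hc' hc]
  obtain rfl := R.exponent_eq hV0 hη hηge hmu ha hc0 hκ hUc fun z hz => hVc z hz.le
  refine ⟨a, c, ha, hc0, hUc', hVc, fun z hz => ?_⟩
  rcases hz.eq_or_lt with rfl | hz
  · rw [mul_zero]; exact R.zero_eq_zero hV0 hu hv
  -- The base and exponent are chosen so that a one-step function on a set of measure M/2 has ⟨V(f)⟩
  -- = z.
  · have hq : 0 < a * z / (M / 2 * c) := by positivity
    have hx := Real.rpow_pos_of_pos hq (1 + κ)⁻¹
    have hxp : ((a * z / (M / 2 * c)) ^ (1 + κ)⁻¹) ^ (1 + κ) = a * z / (M / 2 * c) :=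
      Real.rpow_inv_rpow hq.le (by linarith)
    have hd := R.diagonal_single hV0 hM (half_lt_self R.pos) hx
    have hVz : M / 2 * V ((a * z / (M / 2 * c)) ^ (1 + κ)⁻¹) = z := by
      have hM' := R.pos.ne'
      rw [hVc _ hx.le, hxp]; field_simp
    rw [haV _ hx.le, ← mul_left_comm, hVz] at hd
    exact hd

end TwoStepRelations
-- The characterization
theorem theorem4 (d : ℕ) (hd : 1 ≤ d) (X : Set (EuclideanSpace ℝ (Fin d)))
    (hX : MeasurableSet X) (hXpos : volume X ≠ 0)
    (F : Set (X → ℝ)) (hF : IsRichFamily F)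
    (T : ℝ × ℝ → ℝ) (U V : ℝ → ℝ)
    (hfin : HasFiniteIntegrals F U V)
    (hreg : IsRegularScore F T U V)
    (hproper : IsStrictlyProper F (compositeScore T U V))
    (γ : ℝ) (hγ : 0 < γ) (η u v : ℝ → ℝ)
    (hform : HasHolderForm F γ η u v U V (compositeScore T U V)) :
    ∃ a c : ℝ, a ≠ 0 ∧ c ≠ 0 ∧
      (∀ z, 0 ≤ z → U z = c * z ^ γ) ∧
      (∀ z, 0 ≤ z → V z = c / a * z ^ (1 + γ)) ∧
      (∀ z, 0 ≤ z → u (a * z) = v z) ∧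
      ∀ g ∈ F, ∀ f ∈ F,
        Integrable (fun x => g x * f x ^ γ) (lebesgueOn X) ∧
        Integrable (fun x => f x ^ (1 + γ)) (lebesgueOn X) ∧
        compositeScore T U V g f =
          η (u (c * ∫ x, g x * f x ^ γ ∂lebesgueOn X) /
            u (c * ∫ x, f x ^ (1 + γ) ∂lebesgueOn X)) *
            u (c * ∫ x, f x ^ (1 + γ) ∂lebesgueOn X) := by
  obtain ⟨M, R⟩ := exists_twoStepRelations hd hX hXpos hF hfin hreg hproper hform
  obtain ⟨a, c, ha, hc, hU, hV, huv⟩ := R.power_form hreg.V_zero hform.eta_one hform.eta_ge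
    hform.continuous_u hform.continuous_v hform.strictMono_u hform.strictMono_v
    (hreg.continuous_U 0 Set.self_mem_Ici) hreg.differentiable_U
  refine ⟨a, c, ha.ne', hc.ne', hU, hV, huv, fun g hg f hf => ?_⟩
  have hf0 := (hF.subset_nonneg hf).2.1
  have hgf : (fun x => g x * U (f x)) = fun x => c * (g x * f x ^ γ) := by
    ext x; rw [hU _ (hf0 x)]; ring
  have hff : (fun x => V (f x)) = fun x => c / a * f x ^ (1 + γ) := by
    ext x; rw [hV _ (hf0 x)]
  have hca : c / a ≠ 0 := (div_pos hc ha).ne'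
  refine ⟨?_, ?_, ?_⟩
  · have := hfin.integrable_mul g hg f hf
    rw [hgf] at this
    exact (integrable_const_mul_iff hc.ne'.isUnit _).1 this
  · have := hfin.integrable_comp f hf
    rw [hff] at this
    exact (integrable_const_mul_iff hca.isUnit _).1 this
  · have hI : 0 ≤ ∫ x, f x ^ (1 + γ) ∂lebesgueOn X :=
      integral_nonneg fun x => Real.rpow_nonneg (hf0 x) _
    have hden : v (c / a * ∫ x, f x ^ (1 + γ) ∂lebesgueOn X) =
        u (c * ∫ x, f x ^ (1 + γ) ∂lebesgueOn X) := by
      rw [← huv _ (mul_nonneg (div_pos hc ha).le hI)]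
      congr 1
      field_simp
    rw [hform.score_eq g hg f hf, hgf, hff, integral_const_mul, integral_const_mul, hden]
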